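/- Let $R$ be an associative ring with identity (not necessarily commutative), let $R\text{-Mod}$ be the category of left $R$-modules and $D(R)$ its unbounded derived category. Let $f\colon P^{-1}\to P^0$ be a homomorphism between finitely generated projective left $R$-modules, and let $P_f$ be the complex $\cdots\to 0\to P^{-1}\xrightarrow{f}P^0\to 0\to\cdots$ with $P^{-1}$ in degree $-1$ and $P^0$ in degree $0$. Put $\Sigma=\{f\}$ and let $\Sigma^\perp$ be the full subcategory of $R\text{-Mod}$ consisting of the modules $X$ with $\mathrm{Hom}_{D(R)}(P_f,X[i])=0$ for all $i\in\mathbb Z$. For a module $M$ and a family $\alpha=(a_i\colon P_f\to M[1])_{i\in I}$ of chain maps whose classes generate $\mathrm{Hom}_{D(R)}(P_f,M[1])$ as an $\mathrm{End}_{D(R)}(P_f)$-module, let $\omega\colon P_f^{(I)}\to M[1]$ be the chain map with components $a_i$, let $\overline M=\mathrm{cone}(\omega)[-1]$ with its canonical chain map $M\to\overline M$, let $t(M)\subseteq H^0(\overline M)$ be the sum of the images of all homomorphisms $H^0(P_f)\to H^0(\overline M)$, put $l_\alpha(M)=H^0(\overline M)/t(M)$, and let $\eta_\alpha\colon M\to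 H^0(\overline M)\to l_\alpha(M)$ be the canonical map. Suppose that $\mathrm{Hom}_{D(R)}(P_f,P_f[1])=0$. Then: 1. The inclusion $j\colon\Sigma^\perp\to R\text{-Mod}$ has a left adjoint $l\colon R\text{-Mod}\to\Sigma^\perp$. 2. It is given explicitly as follows: for every choice, for each module $M$, of a generating family $\alpha_M$ as above, there is a left adjoint $l$ of $j$ with isomorphisms $l(M)\cong l_{\alpha_M}(M)$ that carry the unit $M\to l(M)$ of the adjunction to $\eta_{\alpha_M}$. 3. The universal localization $\lambda\colon R\to R_\Sigma$ of $R$ at $\Sigma$ exists (that is, a ring homomorphism $\lambda$ such that $R_\Sigma\otimes_R f$ is an isomorphism, and such that every ring homomorphism $\varphi\colon R\to T$ for which $T\otimes_R f$ is an isomorphism factors uniquely through $\lambda$), and for every left adjoint $l$ of $j$ there is a ring isomorphism $R_\Sigma\cong\mathrm{End}_R(l(R))$. Here endomorphisms of left modules are written on the right, so that the product $st$ in $\mathrm{End}_R(l(R))$ is $s$ followed by $t$. -/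

import Mathlib

open CategoryTheory CategoryTheory.Limits
open scoped TensorProduct

universe w u

noncomputable section

namespace PerpLoc

/-! ### The tensor product over a noncommutative ring, and universal localizations -/

section Localization

variable {R : Type u} [Ring R] {S : Type u} [Ring S] (φ : R →+* S)

/-- The `S`-submodule of `S ⊗_ℤ M` generated by the elements `s φ(r) ⊗ m - s ⊗ r m`. -/
def balancing (M : Type u) [AddCommGroup M] [Module R M] : Submodule S (S ⊗[ℤ] M) :=
  Submodule.span S {x | ∃ (s : S) (r : R) (m : M), x = (s * φ r) ⊗ₜ[ℤ] m - s ⊗ₜ[ℤ] (r • m)}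

/-- The left `S`-module `S ⊗_R M`, for a ring homomorphism `φ : R → S` of (not necessarily
commutative) rings and a left `R`-module `M`. (Mathlib's tensor product needs a commutative
base ring, so this is built as a quotient of the tensor product over `ℤ`.) -/
abbrev BaseChange (M : Type u) [AddCommGroup M] [Module R M] : Type u :=
  (S ⊗[ℤ] M) ⧸ balancing φ M

/-- The map `S ⊗_ℤ M → S ⊗_ℤ N` induced by an `R`-linear map `M → N`. -/
def preMap {M N : Type u} [AddCommGroup M] [Module R M] [AddCommGroup N] [Module R N]
    (α : M →ₗ[R] N) : S ⊗[ℤ] M →ₗ[S] S ⊗[ℤ] N :=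
  TensorProduct.AlgebraTensorModule.lTensor S S α.toAddMonoidHom.toIntLinearMap

theorem balancing_le_comap {M N : Type u} [AddCommGroup M] [Module R M]
    [AddCommGroup N] [Module R N] (α : M →ₗ[R] N) :
    balancing φ M ≤ (balancing φ N).comap (preMap α) := by
  refine Submodule.span_le.2 ?_
  rintro x ⟨s, r, m, rfl⟩
  refine Submodule.subset_span ⟨s, r, α m, ?_⟩
  simp [preMap]

/-- The `S`-linear map `S ⊗_R α : S ⊗_R M → S ⊗_R N` induced by an `R`-linear map `α`. -/
def baseChangeMap {M N : Type u} [AddCommGroup M] [Module R M] [AddCommGroup N] [Module R N]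
    (α : M →ₗ[R] N) : BaseChange φ M →ₗ[S] BaseChange φ N :=
  Submodule.mapQ _ _ (preMap α) (balancing_le_comap φ α)

/-- `φ : R → S` is `{α}`-inverting: `S ⊗_R α` is an isomorphism. -/
def IsInverting {M N : Type u} [AddCommGroup M] [Module R M] [AddCommGroup N] [Module R N]
    (α : M →ₗ[R] N) : Prop :=
  Function.Bijective (baseChangeMap φ α)

/-- `φ : R → S` is the universal localization of `R` at `{α}`: it is `{α}`-inverting, and every
`{α}`-inverting ring homomorphism `R → T` factors uniquely through it. -/
structure IsUniversalLocalization {M N : Type u} [AddCommGroup M] [Module R M]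
    [AddCommGroup N] [Module R N] (α : M →ₗ[R] N) : Prop where
  inverting : IsInverting φ α
  existsUnique_lift : ∀ (T : Type u) [Ring T] (ψ : R →+* T), IsInverting ψ α →
    ∃! χ : S →+* T, χ.comp φ = ψ

end Localization

/-! ### Two-term complexes and the perpendicular category -/

variable {R : Type u} [Ring R] {P₁ P₀ : ModuleCat.{u} R} (f : P₁ ⟶ P₀)

/-- The complex `⋯ → 0 → P₁ → P₀ → 0 → ⋯` with differential `f`, where `P₁` sits in degree `-1`
and `P₀` in degree `0`. -/
def twoTerm : CochainComplex (ModuleCat.{u} R) ℤ :=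
  HomologicalComplex.double f (show (ComplexShape.up ℤ).Rel (-1) 0 by simp)

/-- The stalk complex of `M`, concentrated in degree `0`. -/
abbrev stalk (M : ModuleCat.{u} R) : CochainComplex (ModuleCat.{u} R) ℤ :=
  (HomologicalComplex.single (ModuleCat.{u} R) (ComplexShape.up ℤ) 0).obj M

/-- The perpendicular category of `{f}`: the full subcategory of the modules `X` such that
`Hom_{D(R)}(P_f, X[i]) = 0` for all integers `i`. -/
def perp [HasDerivedCategory.{w} (ModuleCat.{u} R)] : ObjectProperty (ModuleCat.{u} R) :=
  fun X => ∀ (i : ℤ) (g : DerivedCategory.Q.obj (twoTerm f) ⟶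
    (DerivedCategory.Q.obj (stalk X))⟦i⟧), g = 0

/-! ### The explicit reflection -/

/-- A family of chain maps `P_f → M[1]` whose classes generate `Hom_{D(R)}(P_f, M[1])` as a module
over the endomorphism ring of `P_f` in `D(R)`. -/
def Generates [HasDerivedCategory.{w} (ModuleCat.{u} R)] {M : ModuleCat.{u} R} {ι : Type u}
    (a : ι → (twoTerm f ⟶ (stalk M)⟦(1 : ℤ)⟧)) : Prop :=
  ∀ g : DerivedCategory.Q.obj (twoTerm f) ⟶ DerivedCategory.Q.obj ((stalk M)⟦(1 : ℤ)⟧),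
    ∃ c : ι →₀ (DerivedCategory.Q.obj (twoTerm f) ⟶ DerivedCategory.Q.obj (twoTerm f)),
      g = c.sum fun i e => e ≫ DerivedCategory.Q.map (a i)

section Reflection

variable {f} {M : ModuleCat.{u} R} {ι : Type u} (a : ι → (twoTerm f ⟶ (stalk M)⟦(1 : ℤ)⟧))

/-- The map `ω : P_f^(ι) → M[1]` whose components are the members of the family. -/
def omega : (∐ fun _ : ι => twoTerm f) ⟶ (stalk M)⟦(1 : ℤ)⟧ :=
  Sigma.desc a

/-- The complex `cone(ω)[-1]`. -/
def bar : CochainComplex (ModuleCat.{u} R) ℤ :=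
  (CochainComplex.mappingCone (omega a))⟦(-1 : ℤ)⟧

/-- The canonical chain map `M ≅ M[1][-1] → cone(ω)[-1]`. -/
def toBar : stalk M ⟶ bar a :=
  (shiftFunctorCompIsoId (CochainComplex (ModuleCat.{u} R) ℤ) (1 : ℤ) (-1)
      (by norm_num)).inv.app (stalk M) ≫
    (CochainComplex.mappingCone.inr (omega a))⟦(-1 : ℤ)⟧'

/-- The trace of `X` in `Y`: the sum of the images of all homomorphisms from `X` to `Y`. -/
def trace (X Y : ModuleCat.{u} R) : Submodule R Y :=
  ⨆ g : X ⟶ Y, LinearMap.range g.hom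

/-- `H⁰(cone(ω)[-1])` modulo the trace of `H⁰(P_f)` in it. -/
def refl : ModuleCat.{u} R :=
  ModuleCat.of R ((bar a).homology 0 ⧸ trace ((twoTerm f).homology 0) ((bar a).homology 0))

/-- The canonical map from `M ≅ H⁰(M)` to `H⁰(cone(ω)[-1])` and on to its quotient by the trace. -/
def unitMap : M ⟶ refl a :=
  (HomologicalComplex.homologyFunctorSingleIso (ModuleCat.{u} R) (ComplexShape.up ℤ) 0).inv.app M ≫
    HomologicalComplex.homologyMap (toBar a) 0 ≫
      ModuleCat.ofHom (Submodule.mkQ _)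

end Reflection

end PerpLoc

end

/-!
Let `P_f` be the two-term complex of `f : P₁ → P₀`. Its terms are projective, so morphisms from
`P_f` in the derived category are homotopy classes of chain maps. Hence a module `X` is in the
perpendicular category iff every linear map `P₁ → X` extends uniquely along `f`
(`perp_iff_isLocalAt`); such modules are called local below, and `ExtendsAlong` is the existence
half of this condition, that is, `Hom(P_f, X[1]) = 0`. Likewise `Hom(P_f, P_f[1]) = 0` says that
every map `P₁ → P₀` has the form `f s₁ + s₀ f`, and a family of chain maps `P_f → M[1]` generates
iff every map `P₁ → M` is, up to maps that extend along `f`, a finite sum of composites of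
endomorphisms of `P_f` with members of the family.

The module `N = H⁰(cone(ω)[-1])` is the pushout obtained from `M` by glueing on one copy of `P₀`
along each of the maps `P₁ → M` of the family (`comp_glueCell`, `glue_hom_ext`,
`exists_glue_desc`). By generation and rigidity, every map `P₁ → N` extends along `f`
(`ExtendsAlong.of_glueing`). The cokernel of `f`, which is `H⁰(P_f)`, has the extension property by
rigidity, hence so has its trace `t` in `N`, and then `N / t` is local: a map `P₀ → N / t` that
kills `f` lifts to `N`, and the lift can be corrected by a map to `t` to kill `f`
(`ExtendsAlong.isLocalAt_quotient`). A map from `M` to a local module extends uniquely to `N` by the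
pushout property, and it vanishes on `t` since local modules receive no nonzero map from the
cokernel of `f`. So `M → N / t` is a reflection (`existsUnique_unitMap_comp_eq`), and reflections
assemble to a left adjoint (`exists_adjunction`).

For the universal localization, let `R → L` be the reflection of `R`, and let `S` be the
endomorphism ring of `L`, written on the right. Evaluation at the image of `1` identifies `S` with
`L` as an `R`-module, so `S` is local, and so are the retracts `S ⊗_R P₁` and `S ⊗_R P₀` of its
powers; therefore `S ⊗_R f` is bijective (`IsInverting.of_isLocalAt_self`). If `R → T` inverts `f`,
then all `T`-modules are local (`IsInverting.isLocalAt`), and the unique `R`-linear map `L → T` that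
is compatible with the maps from `R` is a ring homomorphism on `S`
(`IsReflectionOfRing.isUniversalLocalization`).
-/

namespace PerpLoc

/-! ### Modules that see `f` as an isomorphism -/

section Local

variable {R : Type*} [Ring R] {P₁ P₀ : Type*} [AddCommGroup P₁] [Module R P₁]
  [AddCommGroup P₀] [Module R P₀]

/-- Every linear map `P₁ → X` extends along `f : P₁ → P₀`; for projective `P₁` and `P₀` this says
`Hom(P_f, X[1]) = 0`. -/
def ExtendsAlong (f : P₁ →ₗ[R] P₀) (X : Type*) [AddCommGroup X] [Module R X] : Prop :=
  Function.Surjective fun g : P₀ →ₗ[R] X => g ∘ₗ f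

/-- For an `S`-module `X`, seen as an `R`-module by means of `φ : R → S`: every `R`-linear map
`P₁ → X` extends uniquely along `f : P₁ → P₀`. For projective `P₁` and `P₀` this says that `X`
belongs to the perpendicular category of `f`. The `R`-linear maps are encoded as `φ`-semilinear
ones, so that `X` need not carry two module structures. -/
def IsLocalAt {S : Type*} [Ring S] (φ : R →+* S) (f : P₁ →ₗ[R] P₀) (X : Type*) [AddCommGroup X]
    [Module S X] : Prop :=
  Function.Bijective fun g : P₀ →ₛₗ[φ] X => g.comp f

variable {f : P₁ →ₗ[R] P₀}

theorem ExtendsAlong.of_surjective {X Y : Type*} [AddCommGroup X] [Module R X] [AddCommGroup Y]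
    [Module R Y] [Module.Projective R P₁] (hX : ExtendsAlong f X)
    (p : X →ₗ[R] Y) (hp : Function.Surjective p) : ExtendsAlong f Y := by
  intro h
  obtain ⟨h', rfl⟩ := Module.projective_lifting_property p h hp
  obtain ⟨g, rfl⟩ := hX h'
  exact ⟨p ∘ₗ g, rfl⟩

variable {S T : Type*} [Ring S] [Ring T] {φ : R →+* S} {ψ : R →+* T}
  {X Y : Type*} [AddCommGroup X] [Module S X] [AddCommGroup Y] [Module T Y]

/-- An `R`-linear retract of a local module is local; the two modules may be given over different
`R`-rings. -/
theorem IsLocalAt.of_retract (hX : IsLocalAt φ f X) (i : Y →+ X) (r : X →+ Y)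
    (hi : ∀ a y, i (ψ a • y) = φ a • i y) (hr : ∀ a x, r (φ a • x) = ψ a • r x)
    (hri : ∀ y, r (i y) = y) : IsLocalAt ψ f Y := by
  let I (g : P₀ →ₛₗ[ψ] Y) : P₀ →ₛₗ[φ] X :=
    { toFun := fun p => i (g p)
      map_add' := fun p q => by simp
      map_smul' := fun a p => by simp [hi] }
  refine ⟨fun g g' h => ?_, fun h => ?_⟩
  · have h1 : I g = I g' := hX.1 (by
      ext p
      exact congrArg i (LinearMap.congr_fun h p))
    ext p
    rw [← hri (g p), ← hri (g' p)]
    exact congrArg r (LinearMap.congr_fun h1 p)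
  · let h' : P₁ →ₛₗ[φ] X :=
      { toFun := fun p => i (h p)
        map_add' := fun p q => by simp
        map_smul' := fun a p => by simp [hi] }
    obtain ⟨g, hg⟩ := hX.2 h'
    refine ⟨{ toFun := fun p => r (g p)
              map_add' := fun p q => by simp
              map_smul' := fun a p => by simp [hr] }, ?_⟩
    ext p
    exact (congrArg r (LinearMap.congr_fun hg p)).trans (hri _)

theorem IsLocalAt.pi {n : Type*} (hX : IsLocalAt φ f X) : IsLocalAt φ f (n → X) := by
  refine ⟨fun g g' h => ?_, fun h => ?_⟩
  · ext p k
    have : (LinearMap.proj (R := S) (φ := fun _ => X) k).comp g =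
        (LinearMap.proj (R := S) (φ := fun _ => X) k).comp g' := hX.1 (by
      ext p
      exact congrFun (LinearMap.congr_fun h p) k)
    exact LinearMap.congr_fun this p
  · choose g hg using fun k => hX.2 ((LinearMap.proj (R := S) (φ := fun _ => X) k).comp h)
    refine ⟨{ toFun := fun p k => g k p
              map_add' := fun p q => by ext; simp
              map_smul' := fun a p => by ext; simp }, ?_⟩
    ext p k
    exact LinearMap.congr_fun (hg k) p

/-- A local module has no nonzero map from the cokernel of `f`. -/
theorem IsLocalAt.eq_zero (hX : IsLocalAt φ f X) {g : P₀ →ₛₗ[φ] X} (hg : g.comp f = 0) : g = 0 :=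
  hX.1 (hg.trans (LinearMap.zero_comp f).symm)

end Local

/-! ### Linear maps out of finitely generated projective modules -/

section RankOne

variable {R : Type*} [Ring R] {P N : Type*} [AddCommGroup P] [Module R P]
  [AddCommGroup N] [Module R N]

theorem exists_dual_basis (R : Type*) [Ring R] (P : Type*) [AddCommGroup P] [Module R P]
    [Module.Finite R P] [Module.Projective R P] :
    ∃ (n : ℕ) (x : Fin n → P) (ξ : Fin n → P →ₗ[R] R), ∀ p, ∑ k, ξ k p • x k = p := by
  obtain ⟨n, r, i, -, -, h⟩ := Module.Finite.exists_comp_eq_id_of_projective R P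
  refine ⟨n, fun k => r (Pi.single k 1), fun k => LinearMap.proj k ∘ₗ i, fun p => ?_⟩
  conv_rhs => rw [← LinearMap.id_apply (R := R) p, ← h, LinearMap.comp_apply,
    pi_eq_sum_univ' (i p)]
  simp only [map_sum, map_smul, LinearMap.comp_apply, LinearMap.proj_apply]

/-- For a group `E` of linear maps `P → N`, the submodule of those `y` in `N` for which all the
rank one maps `p ↦ ξ(p) y` belong to `E`. -/
def rankOneSubmodule (E : AddSubgroup (P →ₗ[R] N)) : Submodule R N where
  carrier := {y | ∀ ξ : P →ₗ[R] R, ξ.smulRight y ∈ E}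
  add_mem' {y z} hy hz ξ := by
    have : ξ.smulRight (y + z) = ξ.smulRight y + ξ.smulRight z := by ext; simp
    rw [this]
    exact E.add_mem (hy ξ) (hz ξ)
  zero_mem' ξ := by
    have : ξ.smulRight (0 : N) = 0 := by ext; simp
    rw [this]
    exact E.zero_mem
  smul_mem' r y hy ξ := by
    have : ξ.smulRight (r • y) = (ξ.smulRight r).smulRight y := by ext; simp [mul_smul]
    rw [this]
    exact hy _

theorem range_le_rankOneSubmodule {E : AddSubgroup (P →ₗ[R] N)} {Y : Type*} [AddCommGroup Y]
    [Module R Y] (k : Y →ₗ[R] N) (hk : ∀ h : P →ₗ[R] Y, k ∘ₗ h ∈ E) :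
    LinearMap.range k ≤ rankOneSubmodule E := by
  rintro _ ⟨y, rfl⟩ ξ
  convert hk (ξ.smulRight y) using 1
  ext
  simp

theorem mem_of_rankOneSubmodule_eq_top [Module.Finite R P] [Module.Projective R P]
    {E : AddSubgroup (P →ₗ[R] N)} (hE : rankOneSubmodule E = ⊤) (g : P →ₗ[R] N) : g ∈ E := by
  obtain ⟨n, x, ξ, h⟩ := exists_dual_basis R P
  have hg : g = ∑ k, (ξ k).smulRight (g (x k)) := by
    ext p
    conv_lhs => rw [← h p]
    simp
  rw [hg]
  exact E.sum_mem fun k _ => (hE.ge trivial : g (x k) ∈ rankOneSubmodule E) (ξ k)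

end RankOne

/-! ### The torsion pair generated by the cokernel of `f` -/

section Torsion

variable {R : Type*} [Ring R] {P₁ P₀ : Type*} [AddCommGroup P₁] [Module R P₁]
  [AddCommGroup P₀] [Module R P₀] {f : P₁ →ₗ[R] P₀}
  {M N X : Type*} [AddCommGroup M] [Module R M] [AddCommGroup N] [Module R N]
  [AddCommGroup X] [Module R X]

/-- The linear maps `P₁ → N` that extend along `f`. -/
def extendable (f : P₁ →ₗ[R] P₀) (N : Type*) [AddCommGroup N] [Module R N] :
    AddSubgroup (P₁ →ₗ[R] N) where
  carrier := {h | ∃ g : P₀ →ₗ[R] N, g ∘ₗ f = h}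
  add_mem' := by
    rintro _ _ ⟨g, rfl⟩ ⟨g', rfl⟩
    exact ⟨g + g', LinearMap.add_comp _ _ _⟩
  zero_mem' := ⟨0, LinearMap.zero_comp _⟩
  neg_mem' := by
    rintro _ ⟨g, rfl⟩
    exact ⟨-g, LinearMap.neg_comp _ _⟩

theorem comp_mem_extendable (k : M →ₗ[R] N) {h : P₁ →ₗ[R] M} (hh : h ∈ extendable f M) :
    k ∘ₗ h ∈ extendable f N := by
  obtain ⟨g, rfl⟩ := hh
  exact ⟨k ∘ₗ g, rfl⟩

/-- Modules generated by the images of modules with the extension property inherit it: `P₁` is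
finitely generated and projective. -/
theorem ExtendsAlong.of_iSup_range [Module.Finite R P₁] [Module.Projective R P₁]
    {C : Type*} [AddCommGroup C] [Module R C] (hC : ExtendsAlong f C) {J : Sort*}
    (k : J → C →ₗ[R] N) : ExtendsAlong f (⨆ j, LinearMap.range (k j) : Submodule R N) := by
  set T : Submodule R N := ⨆ j, LinearMap.range (k j)
  have hk j : LinearMap.range (k j) ≤ T := le_iSup (fun j => LinearMap.range (k j)) j
  intro h
  change h ∈ extendable f T
  refine mem_of_rankOneSubmodule_eq_top ?_ h
  have h1 (j : J) : LinearMap.range (k j) ≤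
      (rankOneSubmodule (extendable f T)).map T.subtype := by
    have h2 := range_le_rankOneSubmodule (E := extendable f T)
      ((k j).codRestrict T fun c => hk j ⟨c, rfl⟩) fun h => comp_mem_extendable _ (hC h)
    rintro _ ⟨c, rfl⟩
    exact ⟨_, h2 ⟨c, rfl⟩, rfl⟩
  rw [eq_top_iff]
  rintro ⟨y, hy⟩ -
  obtain ⟨z, hz, hzy⟩ := iSup_le h1 hy
  rwa [← show z = ⟨y, hy⟩ from Subtype.ext hzy]

/-- If `N` and its submodule `T` have the extension property and `T` contains the image of every
map from the cokernel of `f`, then `N ⧸ T` is local: a map `P₀ → N ⧸ T` that kills `f` lifts to `N`,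
and the lift can be corrected by a map to `T` to kill `f`, too. -/
theorem ExtendsAlong.isLocalAt_quotient [Module.Projective R P₁] [Module.Projective R P₀]
    (hN : ExtendsAlong f N) (T : Submodule R N) (hT : ExtendsAlong f T)
    (hle : ∀ g : P₀ →ₗ[R] N, g ∘ₗ f = 0 → LinearMap.range g ≤ T) :
    IsLocalAt (RingHom.id R) f (N ⧸ T) := by
  refine ⟨?_, hN.of_surjective T.mkQ T.mkQ_surjective⟩
  suffices ∀ g : P₀ →ₗ[R] N ⧸ T, g ∘ₗ f = 0 → g = 0 by
    intro g g' h
    rw [← sub_eq_zero]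
    refine this _ ?_
    rw [LinearMap.sub_comp, sub_eq_zero]
    exact h
  intro g hg
  obtain ⟨g', rfl⟩ := Module.projective_lifting_property T.mkQ g T.mkQ_surjective
  have h1 x : g' (f x) ∈ T := by
    rw [← Submodule.Quotient.mk_eq_zero]
    exact LinearMap.congr_fun hg x
  obtain ⟨s, hs⟩ := hT ((g' ∘ₗ f).codRestrict T h1)
  have h2 : (g' - T.subtype ∘ₗ s) ∘ₗ f = 0 := by
    ext x
    have := congrArg Subtype.val (LinearMap.congr_fun hs x)
    simp only [LinearMap.comp_apply, LinearMap.codRestrict_apply] at this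
    simp [this]
  ext p
  have h3 := add_mem (hle _ h2 ⟨p, rfl⟩) (s p).2
  simp only [LinearMap.sub_apply, LinearMap.comp_apply, Submodule.subtype_apply,
    sub_add_cancel] at h3
  simpa using h3

/-- The module `N` obtained from `M` by glueing on copies of `P₀` along maps `α i : P₁ → M` has the
extension property, as soon as the `α i` generate `Hom(P_f, M[1])` and `Hom(P_f, P_f[1]) = 0`. -/
theorem ExtendsAlong.of_glueing [Module.Finite R P₁] [Module.Projective R P₁] {ι : Type*}
    {α : ι → P₁ →ₗ[R] M} {ν : M →ₗ[R] N} {ρ : ι → P₀ →ₗ[R] N}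
    (hρ : ∀ i, ρ i ∘ₗ f = ν ∘ₗ α i)
    (htop : LinearMap.range ν ⊔ ⨆ i, LinearMap.range (ρ i) = ⊤)
    (hf : ∀ h : P₁ →ₗ[R] P₀, ∃ (s₁ : P₁ →ₗ[R] P₁) (s₀ : P₀ →ₗ[R] P₀), h = f ∘ₗ s₁ + s₀ ∘ₗ f)
    (hα : ∀ h : P₁ →ₗ[R] M, ∃ (s : Finset ι) (e₁ : ι → P₁ →ₗ[R] P₁) (e₀ : ι → P₀ →ₗ[R] P₀)
      (g : P₀ →ₗ[R] M), (∀ i, f ∘ₗ e₁ i = e₀ i ∘ₗ f) ∧ h = ∑ i ∈ s, α i ∘ₗ e₁ i + g ∘ₗ f) :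
    ExtendsAlong f N := by
  have hν (h : P₁ →ₗ[R] M) : ν ∘ₗ h ∈ extendable f N := by
    obtain ⟨s, e₁, e₀, g, he, rfl⟩ := hα h
    rw [LinearMap.comp_add, show ν ∘ₗ ∑ i ∈ s, α i ∘ₗ e₁ i = ∑ i ∈ s, ν ∘ₗ α i ∘ₗ e₁ i by
      ext; simp]
    refine add_mem (sum_mem fun i _ => ⟨ρ i ∘ₗ e₀ i, ?_⟩) ⟨ν ∘ₗ g, rfl⟩
    rw [LinearMap.comp_assoc, ← he, ← LinearMap.comp_assoc, hρ, LinearMap.comp_assoc]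
  intro h
  refine mem_of_rankOneSubmodule_eq_top (E := extendable f N) (eq_top_iff.2 ?_) h
  rw [← htop]
  refine sup_le (range_le_rankOneSubmodule _ hν)
    (iSup_le fun i => range_le_rankOneSubmodule _ fun h => ?_)
  obtain ⟨s₁, s₀, rfl⟩ := hf h
  rw [LinearMap.comp_add]
  refine add_mem ?_ ⟨ρ i ∘ₗ s₀, rfl⟩
  rw [← LinearMap.comp_assoc, hρ, LinearMap.comp_assoc]
  exact hν _

end Torsion

/-! ### Base change and local modules -/

section BaseChange

variable {R : Type u} [Ring R] {S : Type u} [Ring S] (φ : R →+* S)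
  {M N : Type u} [AddCommGroup M] [Module R M] [AddCommGroup N] [Module R N]
  {Y : Type u} [AddCommGroup Y] [Module S Y]

/-- The canonical map `M → S ⊗_R M`, `m ↦ 1 ⊗ m`. -/
def BaseChange.unit (M : Type u) [AddCommGroup M] [Module R M] : M →ₛₗ[φ] BaseChange φ M where
  toFun m := (balancing φ M).mkQ (1 ⊗ₜ[ℤ] m)
  map_add' m m' := by rw [TensorProduct.tmul_add, map_add]
  map_smul' r m := by
    rw [← map_smul, ← sub_eq_zero, ← map_sub, ← neg_sub, map_neg, neg_eq_zero,
      Submodule.mkQ_apply, Submodule.Quotient.mk_eq_zero]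
    refine Submodule.subset_span ⟨1, r, m, ?_⟩
    rw [TensorProduct.smul_tmul', smul_eq_mul, mul_one, one_mul]

variable {φ}

/-- The `S`-linear map `S ⊗_R M → Y`, `s ⊗ m ↦ s g(m)`. -/
def BaseChange.lift (g : M →ₛₗ[φ] Y) : BaseChange φ M →ₗ[S] Y :=
  (balancing φ M).liftQ
    (TensorProduct.AlgebraTensorModule.lift
      (LinearMap.toSpanSingleton S (M →ₗ[ℤ] Y) g.toAddMonoidHom.toIntLinearMap)) <| by
    refine Submodule.span_le.2 ?_
    rintro _ ⟨s, r, m, rfl⟩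
    simp [mul_smul]

@[simp]
theorem BaseChange.lift_unit (g : M →ₛₗ[φ] Y) (m : M) :
    BaseChange.lift g (BaseChange.unit φ M m) = g m := by
  refine (Submodule.liftQ_apply _ _ _).trans ?_
  simp

theorem BaseChange.hom_ext {g g' : BaseChange φ M →ₗ[S] Y}
    (h : ∀ m, g (BaseChange.unit φ M m) = g' (BaseChange.unit φ M m)) : g = g' := by
  refine Submodule.linearMap_qext _ (TensorProduct.AlgebraTensorModule.ext fun s m => ?_)
  have : (s ⊗ₜ[ℤ] m : S ⊗[ℤ] M) = s • (1 ⊗ₜ[ℤ] m) := by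
    rw [TensorProduct.smul_tmul', smul_eq_mul, mul_one]
  rw [this, map_smul, map_smul]
  exact congrArg (s • ·) (h m)

@[simp]
theorem baseChangeMap_unit (α : M →ₗ[R] N) (m : M) :
    baseChangeMap φ α (BaseChange.unit φ M m) = BaseChange.unit φ N (α m) := by
  simp [baseChangeMap, BaseChange.unit, preMap]

variable {f : M →ₗ[R] N}

/-- If `S ⊗_R f` is bijective, every `S`-module is local over `R`. -/
theorem IsInverting.isLocalAt (h : IsInverting φ f) (Y : Type u) [AddCommGroup Y] [Module S Y] :
    IsLocalAt φ f Y := by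
  refine ⟨fun g g' hg => ?_, fun g => ?_⟩
  · have h1 : BaseChange.lift g ∘ₗ baseChangeMap φ f = BaseChange.lift g' ∘ₗ baseChangeMap φ f :=
      BaseChange.hom_ext fun m => by simpa using LinearMap.congr_fun hg m
    have h2 : BaseChange.lift g = BaseChange.lift g' := by
      refine LinearMap.ext fun y => ?_
      obtain ⟨x, rfl⟩ := h.2 y
      exact LinearMap.congr_fun h1 x
    ext m
    simpa using LinearMap.congr_fun h2 (BaseChange.unit φ N m)
  · let e := LinearEquiv.ofBijective (baseChangeMap φ f) h
    refine ⟨((BaseChange.lift g ∘ₗ e.symm.toLinearMap).comp (BaseChange.unit φ N)), ?_⟩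
    ext m
    have : e.symm (BaseChange.unit φ N (f m)) = BaseChange.unit φ M m := by
      rw [LinearEquiv.symm_apply_eq]
      exact (baseChangeMap_unit f m).symm
    simp [this]

/-- The inverse of `S ⊗_R f` is induced by the extension along `f` of `M → S ⊗_R M`. -/
theorem IsInverting.of_isLocalAt (hM : IsLocalAt φ f (BaseChange φ M))
    (hN : IsLocalAt φ f (BaseChange φ N)) : IsInverting φ f := by
  obtain ⟨g, hg⟩ := hM.2 (BaseChange.unit φ M)
  have hg' m : g (f m) = BaseChange.unit φ M m := LinearMap.congr_fun hg m
  have h1 : BaseChange.lift g ∘ₗ baseChangeMap φ f = LinearMap.id :=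
    BaseChange.hom_ext fun m => by simp [hg']
  have h2 : (baseChangeMap φ f).comp g = BaseChange.unit φ N := hN.1 (by
    ext m
    simp [hg'])
  have h3 : baseChangeMap φ f ∘ₗ BaseChange.lift g = LinearMap.id :=
    BaseChange.hom_ext fun m => by simpa using LinearMap.congr_fun h2 m
  exact Function.bijective_iff_has_inverse.2
    ⟨BaseChange.lift g, LinearMap.congr_fun h1, LinearMap.congr_fun h3⟩

/-- For finitely generated projective `P`, the module `S ⊗_R P` is a retract of a power of `S`. -/
theorem IsLocalAt.baseChange (hS : IsLocalAt φ f S) (P : Type u) [AddCommGroup P] [Module R P]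
    [Module.Finite R P] [Module.Projective R P] : IsLocalAt φ f (BaseChange φ P) := by
  obtain ⟨n, x, ξ, h⟩ := exists_dual_basis R P
  let i : BaseChange φ P →ₗ[S] (Fin n → S) := BaseChange.lift
    { toFun := fun p k => φ (ξ k p)
      map_add' := fun p q => by ext; simp
      map_smul' := fun r p => by ext; simp }
  let r : (Fin n → S) →ₗ[S] BaseChange φ P :=
    Fintype.linearCombination S fun k => BaseChange.unit φ P (x k)
  have hri : r ∘ₗ i = LinearMap.id := BaseChange.hom_ext fun p => by
    have : i (BaseChange.unit φ P p) = fun k => φ (ξ k p) := BaseChange.lift_unit _ p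
    rw [LinearMap.comp_apply, this, LinearMap.id_apply]
    conv_rhs => rw [← h p]
    simp [r, Fintype.linearCombination_apply]
  exact (hS.pi (n := Fin n)).of_retract i.toAddMonoidHom r.toAddMonoidHom
    (fun a y => map_smul i _ _) (fun a y => map_smul r _ _) (LinearMap.congr_fun hri)

theorem IsInverting.of_isLocalAt_self [Module.Finite R M] [Module.Projective R M]
    [Module.Finite R N] [Module.Projective R N] (hS : IsLocalAt φ f S) : IsInverting φ f :=
  .of_isLocalAt (hS.baseChange M) (hS.baseChange N)

/-- Universal localizations are unique up to isomorphism. -/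
theorem IsUniversalLocalization.nonempty_ringEquiv {T : Type u} [Ring T] {ψ : R →+* T}
    (hφ : IsUniversalLocalization φ f) (hψ : IsUniversalLocalization ψ f) :
    Nonempty (S ≃+* T) := by
  obtain ⟨χ, hχ, -⟩ := hφ.existsUnique_lift T ψ hψ.inverting
  obtain ⟨θ, hθ, -⟩ := hψ.existsUnique_lift S φ hφ.inverting
  refine ⟨RingEquiv.ofRingHom χ θ ?_ ?_⟩
  · exact (hψ.existsUnique_lift T ψ hψ.inverting).unique
      (by rw [RingHom.comp_assoc, hθ, hχ]) (RingHom.id_comp ψ)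
  · exact (hφ.existsUnique_lift S φ hφ.inverting).unique
      (by rw [RingHom.comp_assoc, hχ, hθ]) (RingHom.id_comp φ)

end BaseChange

/-! ### The endomorphism ring of the reflection of `R` -/

section Endomorphisms

variable {R : Type u} [Ring R] {P₁ P₀ : Type u} [AddCommGroup P₁] [Module R P₁]
  [AddCommGroup P₀] [Module R P₀]

/-- The element `v` of the local module `L` is universal among the elements of local modules: the
map `R → L`, `r ↦ r v`, is a reflection of `R` in the category of local modules. -/
structure IsReflectionOfRing (f : P₁ →ₗ[R] P₀) {L : Type u} [AddCommGroup L] [Module R L]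
    (v : L) : Prop where
  isLocalAt : IsLocalAt (RingHom.id R) f L
  existsUnique : ∀ (X : Type u) [AddCommGroup X] [Module R X], IsLocalAt (RingHom.id R) f X →
    ∀ x : X, ∃! t : L →ₗ[R] X, t v = x

namespace IsReflectionOfRing

variable {f : P₁ →ₗ[R] P₀} {L : Type u} [AddCommGroup L] [Module R L] {v : L}

theorem hom_ext (h : IsReflectionOfRing f v) {X : Type u} [AddCommGroup X] [Module R X]
    (hX : IsLocalAt (RingHom.id R) f X)
    {t t' : L →ₗ[R] X} (ht : t v = t' v) : t = t' :=
  (h.existsUnique X hX _).unique ht rfl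

variable (h : IsReflectionOfRing f v)

/-- The endomorphism of `L` that takes `v` to `x`. -/
noncomputable def endOf (x : L) : Module.End R L := (h.existsUnique L h.isLocalAt x).choose

@[simp]
theorem endOf_apply (x : L) : h.endOf x v = x := (h.existsUnique L h.isLocalAt x).choose_spec.1

/-- The ring homomorphism from `R` to the endomorphism ring of `L`, with endomorphisms written on
the right, that takes `r` to the endomorphism `v ↦ r v`. -/
noncomputable def toEnd : R →+* (Module.End R L)ᵐᵒᵖ where
  toFun r := .op (h.endOf (r • v))
  map_one' := by
    refine MulOpposite.unop_injective (h.hom_ext h.isLocalAt ?_)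
    simp
  map_mul' r s := by
    refine MulOpposite.unop_injective (h.hom_ext h.isLocalAt ?_)
    simp [mul_smul]
  map_zero' := by
    refine MulOpposite.unop_injective (h.hom_ext h.isLocalAt ?_)
    simp
  map_add' r s := by
    refine MulOpposite.unop_injective (h.hom_ext h.isLocalAt ?_)
    simp [add_smul]

@[simp]
theorem unop_toEnd_apply (r : R) : (h.toEnd r).unop v = r • v := h.endOf_apply _

/-- As an `R`-module, the endomorphism ring of `L` is `L`, by evaluation at `v`. -/
theorem isLocalAt_end : IsLocalAt h.toEnd f (Module.End R L)ᵐᵒᵖ := by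
  let r : L →+ (Module.End R L)ᵐᵒᵖ :=
    { toFun := fun x => .op (h.endOf x)
      map_zero' := MulOpposite.unop_injective (h.hom_ext h.isLocalAt (by simp))
      map_add' := fun x y => MulOpposite.unop_injective (h.hom_ext h.isLocalAt (by simp)) }
  let i : (Module.End R L)ᵐᵒᵖ →+ L :=
    { toFun := fun s => s.unop v
      map_zero' := by simp
      map_add' := fun x y => by simp }
  refine h.isLocalAt.of_retract i r (fun a s => ?_) (fun a x => ?_) (fun s => ?_)
  · simp [i]
  · exact MulOpposite.unop_injective (h.hom_ext h.isLocalAt (by simp [r]))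
  · exact MulOpposite.unop_injective (h.hom_ext h.isLocalAt (by simp [r, i]))

/-- The endomorphism ring of the reflection of `R` is the universal localization. If `ψ : R → T` is
inverting, then `T` is a local `R`-module, and the `R`-linear map `L → T` with `v ↦ 1` is the
desired ring homomorphism. -/
theorem isUniversalLocalization [Module.Finite R P₁] [Module.Projective R P₁]
    [Module.Finite R P₀] [Module.Projective R P₀] : IsUniversalLocalization h.toEnd f where
  inverting := .of_isLocalAt_self h.isLocalAt_end
  existsUnique_lift T _ ψ hψ := by
    let _ : Module R T := Module.compHom T ψ
    have smul_def (r : R) (t : T) : r • t = ψ r * t := rfl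
    have hT : IsLocalAt (RingHom.id R) f T :=
      (hψ.isLocalAt T).of_retract (.id T) (.id T) (fun _ _ => rfl) (fun _ _ => rfl) fun _ => rfl
    obtain ⟨χ, hχ, -⟩ := h.existsUnique T hT 1
    -- For fixed `s`, both sides are values at `v` of `R`-linear maps in the argument `t v`.
    have hmul (s t : Module.End R L) : χ (s (t v)) = χ (t v) * χ (s v) := by
      let m : L →ₗ[R] T :=
        { toFun := fun x => χ x * χ (s v)
          map_add' := fun x y => by rw [map_add, add_mul]
          map_smul' := fun r x => by
            rw [map_smul, smul_def, mul_assoc, RingHom.id_apply, smul_def] }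
      have : χ ∘ₗ s = m := h.hom_ext hT (by simp [m, hχ])
      exact LinearMap.congr_fun this (t v)
    let θ : (Module.End R L)ᵐᵒᵖ →+* T :=
      { toFun := fun s => χ (s.unop v)
        map_one' := by simpa using hχ
        map_mul' := fun s t => by simpa using hmul t.unop s.unop
        map_zero' := by simp
        map_add' := fun s t => by simp }
    refine ⟨θ, ?_, fun θ' hθ' => ?_⟩
    · ext r
      change χ ((h.toEnd r).unop v) = ψ r
      rw [unop_toEnd_apply, map_smul, hχ, smul_def, mul_one]
    · have h1 (r : R) : θ' (h.toEnd r) = ψ r := RingHom.congr_fun hθ' r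
      have h2 (x : L) (r : R) : (MulOpposite.op (h.endOf (r • x)) : (Module.End R L)ᵐᵒᵖ) =
          h.toEnd r * .op (h.endOf x) :=
        MulOpposite.unop_injective (h.hom_ext h.isLocalAt (by simp))
      have h3 (x y : L) : (MulOpposite.op (h.endOf (x + y)) : (Module.End R L)ᵐᵒᵖ) =
          .op (h.endOf x) + .op (h.endOf y) :=
        MulOpposite.unop_injective (h.hom_ext h.isLocalAt (by simp))
      let m : L →ₗ[R] T :=
        { toFun := fun x => θ' (.op (h.endOf x))
          map_add' := fun x y => by rw [h3, map_add]
          map_smul' := fun r x => by rw [h2, map_mul, h1, RingHom.id_apply, smul_def] }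
      have h4 (s : Module.End R L) : h.endOf (s v) = s := h.hom_ext h.isLocalAt (by simp)
      have h5 : m = χ := h.hom_ext hT (by
        have := h4 1
        rw [Module.End.one_apply] at this
        simp [m, this, hχ])
      ext s
      change θ' s = χ (s.unop v)
      rw [← h5]
      change θ' s = θ' (.op (h.endOf (s.unop v)))
      rw [h4, MulOpposite.op_unop]

end IsReflectionOfRing

end Endomorphisms

/-! ### Morphisms from a two-term complex of projectives in the derived category -/

section Derived

open CochainComplex

variable {R : Type u} [Ring R] {P₁ P₀ : ModuleCat.{u} R} (f : P₁ ⟶ P₀)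

/-- The term of degree `-1` of `twoTerm f`. -/
noncomputable def twoTermX₁ : (twoTerm f).X (-1) ≅ P₁ := HomologicalComplex.doubleXIso₀ f _

/-- The term of degree `0` of `twoTerm f`. -/
noncomputable def twoTermX₀ : (twoTerm f).X 0 ≅ P₀ :=
  HomologicalComplex.doubleXIso₁ f _ (by decide)

theorem twoTerm_d : (twoTerm f).d (-1) 0 = (twoTermX₁ f).hom ≫ f ≫ (twoTermX₀ f).inv :=
  HomologicalComplex.double_d f _ (by decide)

theorem isZero_twoTerm_X (k : ℤ) (h₁ : k ≠ -1) (h₀ : k ≠ 0) : IsZero ((twoTerm f).X k) :=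
  HomologicalComplex.isZero_double_X f _ k h₁ h₀

theorem isKProjective_twoTerm [Module.Projective R P₁] [Module.Projective R P₀] :
    (twoTerm f).IsKProjective := by
  have : (twoTerm f).IsStrictlyLE 0 := by
    rw [isStrictlyLE_iff]
    exact fun i hi => isZero_twoTerm_X f i (by lia) (by lia)
  have (n : ℤ) : Projective ((twoTerm f).X n) := by
    by_cases h₁ : n = -1
    · subst h₁
      exact Projective.of_iso (twoTermX₁ f).symm ((IsProjective.iff_projective P₁).1 inferInstance)
    by_cases h₀ : n = 0
    · subst h₀
      exact Projective.of_iso (twoTermX₀ f).symm ((IsProjective.iff_projective P₀).1 inferInstance)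
    exact Projective.of_iso (isZero_twoTerm_X f n h₁ h₀).isoZero.symm inferInstance
  exact isKProjective_of_projective _ 0

variable {f} in
/-- A morphism from `twoTerm f` to `K` is given by its components in the degrees `-1` and `0`. -/
theorem exists_twoTerm_hom {K : CochainComplex (ModuleCat.{u} R) ℤ} (φ₁ : P₁ ⟶ K.X (-1))
    (φ₀ : P₀ ⟶ K.X 0) (comm : φ₁ ≫ K.d (-1) 0 = f ≫ φ₀) (h : φ₀ ≫ K.d 0 1 = 0) :
    ∃ φ : twoTerm f ⟶ K, φ.f (-1) = (twoTermX₁ f).hom ≫ φ₁ ∧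
      φ.f 0 = (twoTermX₀ f).hom ≫ φ₀ :=
  ⟨HomologicalComplex.mkHomFromDouble _ (by decide) φ₁ φ₀ comm (by
      rintro k hk
      obtain rfl : k = 1 := by simpa using hk.symm
      exact h),
    HomologicalComplex.mkHomFromDouble_f₀ _ _ _ _ _ _,
    HomologicalComplex.mkHomFromDouble_f₁ _ _ _ _ _ _⟩

theorem isZero_stalk_shift_X (X : ModuleCat.{u} R) (i p : ℤ) (h : p + i ≠ 0) :
    IsZero (((stalk X)⟦i⟧).X p) :=
  (HomologicalComplex.isZero_single_obj_X (ComplexShape.up ℤ) 0 X (p + i) h).of_iso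
    ((stalk X).shiftFunctorObjXIso i p (p + i) rfl)

/-- The term of degree `-1` of `X[1]`. -/
noncomputable def stalkShiftX (X : ModuleCat.{u} R) : ((stalk X)⟦(1 : ℤ)⟧).X (-1) ≅ X :=
  (stalk X).shiftFunctorObjXIso 1 (-1) 0 (by simp) ≪≫
    HomologicalComplex.singleObjXSelf (ComplexShape.up ℤ) 0 X

variable [HasDerivedCategory.{w} (ModuleCat.{u} R)]
variable {f}

theorem Q_map_surjective {P K : CochainComplex (ModuleCat.{u} R) ℤ} [P.IsKProjective] :
    Function.Surjective (DerivedCategory.Q.map : (P ⟶ K) → _) := by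
  intro g
  obtain ⟨h, hh⟩ := (IsKProjective.Qh_map_bijective P _).surjective
    ((DerivedCategory.quotientCompQhIso _).hom.app P ≫ g ≫
      (DerivedCategory.quotientCompQhIso _).inv.app K)
  obtain ⟨φ, rfl⟩ := (HomotopyCategory.quotient _ _).map_surjective h
  refine ⟨φ, ?_⟩
  have := (DerivedCategory.quotientCompQhIso (ModuleCat.{u} R)).hom.naturality φ
  dsimp only [Functor.comp_map] at this
  rw [hh] at this
  simpa using this.symm

theorem nonempty_homotopy_of_Q_map_eq_zero {P K : CochainComplex (ModuleCat.{u} R) ℤ}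
    [P.IsKProjective] {φ : P ⟶ K} (hφ : DerivedCategory.Q.map φ = 0) :
    Nonempty (Homotopy φ 0) := by
  refine ⟨HomotopyCategory.homotopyOfEq _ _ ((IsKProjective.Qh_map_bijective P _).injective ?_)⟩
  have := (DerivedCategory.quotientCompQhIso (ModuleCat.{u} R)).hom.naturality φ
  dsimp only [Functor.comp_map] at this
  rw [hφ, comp_zero] at this
  rw [Functor.map_zero, Functor.map_zero]
  exact (cancel_mono _).1 (this.trans zero_comp.symm)

/-- The two components of a null homotopy of a chain map from `twoTerm f`. -/
theorem exists_of_Q_map_eq_zero [Module.Projective R P₁] [Module.Projective R P₀]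
    {K : CochainComplex (ModuleCat.{u} R) ℤ} {φ : twoTerm f ⟶ K}
    (hφ : DerivedCategory.Q.map φ = 0) :
    ∃ (s₀ : P₀ ⟶ K.X (-1)) (s₁ : P₁ ⟶ K.X (-2)),
      (twoTermX₁ f).inv ≫ φ.f (-1) = f ≫ s₀ + s₁ ≫ K.d (-2) (-1) ∧
      (twoTermX₀ f).inv ≫ φ.f 0 = s₀ ≫ K.d (-1) 0 := by
  have := isKProjective_twoTerm f
  obtain ⟨H⟩ := nonempty_homotopy_of_Q_map_eq_zero hφ
  refine ⟨(twoTermX₀ f).inv ≫ H.hom 0 (-1), (twoTermX₁ f).inv ≫ H.hom (-1) (-2), ?_, ?_⟩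
  · have h := H.comm (-1)
    rw [dNext_eq H.hom (show (ComplexShape.up ℤ).Rel (-1) 0 by simp),
      prevD_eq H.hom (show (ComplexShape.up ℤ).Rel (-2) (-1) by simp), twoTerm_d] at h
    rw [h]
    simp
  · have h := H.comm 0
    have hz : (twoTerm f).d 0 1 = 0 :=
      (isZero_twoTerm_X f 1 (by decide) (by decide)).eq_of_tgt _ _
    rw [dNext_eq H.hom (show (ComplexShape.up ℤ).Rel 0 1 by simp),
      prevD_eq H.hom (show (ComplexShape.up ℤ).Rel (-1) 0 by simp), hz] at h
    rw [h]
    simp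

open HomComplex in
/-- A map `P_f → X[1]` whose component `P₁ → X` extends along `f` is null homotopic. -/
theorem Q_map_eq_zero_of_eq {X : ModuleCat.{u} R} {φ : twoTerm f ⟶ (stalk X)⟦(1 : ℤ)⟧}
    (s : P₀ ⟶ ((stalk X)⟦(1 : ℤ)⟧).X (-1)) (hs : (twoTermX₁ f).inv ≫ φ.f (-1) = f ≫ s) :
    DerivedCategory.Q.map φ = 0 := by
  have H : Homotopy φ 0 := (Cochain.equivHomotopy φ 0).symm
    ⟨Cochain.single ((twoTermX₀ f).hom ≫ s) (-1), by
      refine Cochain.ext₀ _ _ fun p => ?_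
      rw [Cochain.δ_single _ (-1) 0 (by simp) (-1) 0 (by simp) (by simp)]
      by_cases hp : p = -1
      · subst hp
        have : φ.f (-1) = (twoTermX₁ f).hom ≫ f ≫ s := by rw [← hs, Iso.hom_inv_id_assoc]
        rw [Cochain.add_v, Cochain.add_v,
          Cochain.single_v_eq_zero' _ 0 (-1) (-1) _ (by decide), zero_add]
        simp only [this, twoTerm_d, Int.negOnePow_zero, one_smul, Cochain.ofHom_v,
          HomologicalComplex.zero_f, Category.assoc, Iso.inv_hom_id_assoc]
        exact ((add_zero _).trans (Cochain.single_v _ _ _)).symm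
      · exact (isZero_stalk_shift_X X 1 p (by lia)).eq_of_tgt _ _⟩
  rw [DerivedCategory.Q_map_eq_of_homotopy _ H, Functor.map_zero]

/-- A module is in the perpendicular category if and only if it is local. -/
theorem perp_iff_isLocalAt [Module.Projective R P₁] [Module.Projective R P₀]
    (X : ModuleCat.{u} R) : perp f X ↔ IsLocalAt (RingHom.id R) f.hom X := by
  have := isKProjective_twoTerm f
  constructor
  · intro hX
    refine ⟨?_, fun h => ?_⟩
    · suffices ∀ h : P₀ ⟶ X, f ≫ h = 0 → h = 0 by
        intro g g' h
        have h1 := this (ModuleCat.ofHom (g - g')) (by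
          ext x
          simpa [sub_eq_zero] using LinearMap.congr_fun h x)
        rw [← sub_eq_zero]
        exact congrArg ModuleCat.Hom.hom h1
      intro h hh
      obtain ⟨φ, -, hφ⟩ := exists_twoTerm_hom (f := f) (K := stalk X) 0
        (h ≫ (HomologicalComplex.singleObjXSelf (ComplexShape.up ℤ) 0 X).inv)
        (by rw [reassoc_of% hh, zero_comp, zero_comp]) (by simp)
      have h0 : DerivedCategory.Q.map φ = 0 := by
        have := hX 0 (DerivedCategory.Q.map φ ≫
          (shiftFunctorZero (DerivedCategory (ModuleCat.{u} R)) ℤ).inv.app _)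
        exact (cancel_mono _).1 (this.trans zero_comp.symm)
      obtain ⟨s₀, -, -, hs⟩ := exists_of_Q_map_eq_zero h0
      rw [hφ, Iso.inv_hom_id_assoc,
        (HomologicalComplex.isZero_single_obj_X (ComplexShape.up ℤ) 0 X (-1)
          (by decide)).eq_of_tgt s₀ 0, zero_comp] at hs
      exact (cancel_mono _).1 (hs.trans zero_comp.symm)
    · obtain ⟨φ, hφ, -⟩ := exists_twoTerm_hom (f := f) (K := (stalk X)⟦(1 : ℤ)⟧)
        (ModuleCat.ofHom h ≫ (stalkShiftX X).inv) 0
        ((isZero_stalk_shift_X X 1 0 (by decide)).eq_of_tgt _ _) zero_comp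
      have h0 : DerivedCategory.Q.map φ = 0 := by
        have := hX 1 (DerivedCategory.Q.map φ ≫
          (DerivedCategory.Q.commShiftIso (1 : ℤ)).hom.app (stalk X))
        exact (cancel_mono _).1 (this.trans zero_comp.symm)
      obtain ⟨s₀, s₁, hs, -⟩ := exists_of_Q_map_eq_zero h0
      rw [hφ, Iso.inv_hom_id_assoc,
        (isZero_stalk_shift_X X 1 (-2) (by decide)).eq_of_tgt s₁ 0, zero_comp, add_zero,
        Iso.comp_inv_eq, Category.assoc] at hs
      exact ⟨(s₀ ≫ (stalkShiftX X).hom).hom, (congrArg ModuleCat.Hom.hom hs).symm⟩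
  · intro hX i g
    suffices ∀ φ : twoTerm f ⟶ (stalk X)⟦i⟧, DerivedCategory.Q.map φ = 0 by
      obtain ⟨φ, hφ⟩ := Q_map_surjective
        (g ≫ (DerivedCategory.Q.commShiftIso i).inv.app (stalk X))
      rw [this] at hφ
      exact (cancel_mono _).1 (hφ.symm.trans zero_comp.symm)
    intro φ
    by_cases hi : i = 1
    · subst hi
      obtain ⟨g, hg⟩ := hX.2 ((twoTermX₁ f).inv ≫ φ.f (-1) ≫ (stalkShiftX X).hom).hom
      refine Q_map_eq_zero_of_eq (ModuleCat.ofHom g ≫ (stalkShiftX X).inv) ?_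
      rw [← Category.assoc f, Iso.eq_comp_inv, Category.assoc]
      ext x
      exact (LinearMap.congr_fun hg x).symm
    suffices φ = 0 by rw [this, Functor.map_zero]
    refine HomologicalComplex.from_double_hom_ext
      ((isZero_stalk_shift_X X i (-1) (by lia)).eq_of_tgt _ _) ?_
    by_cases hi0 : i = 0
    · subst hi0
      let e : ((stalk X)⟦(0 : ℤ)⟧).X 0 ≅ X := (stalk X).shiftFunctorObjXIso 0 0 0 (by simp) ≪≫
        HomologicalComplex.singleObjXSelf (ComplexShape.up ℤ) 0 X
      have h1 : (twoTerm f).d (-1) 0 ≫ φ.f 0 = 0 := by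
        rw [← φ.comm]
        exact (isZero_stalk_shift_X X 0 (-1) (by decide)).eq_of_tgt (φ.f (-1)) 0 ▸ zero_comp
      rw [twoTerm_d, Category.assoc, Category.assoc] at h1
      have h2 : f ≫ (twoTermX₀ f).inv ≫ φ.f 0 = 0 :=
        (cancel_epi (twoTermX₁ f).hom).1 (h1.trans comp_zero.symm)
      have h3 := hX.eq_zero (g := ((twoTermX₀ f).inv ≫ φ.f 0 ≫ e.hom).hom) (by
        ext x
        have := congrArg (· ≫ e.hom) h2
        simp only [Category.assoc, zero_comp] at this
        exact LinearMap.congr_fun (congrArg ModuleCat.Hom.hom this) x)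
      have h4 : (twoTermX₀ f).inv ≫ φ.f 0 ≫ e.hom = 0 := ModuleCat.hom_ext h3
      rw [Iso.inv_comp_eq, comp_zero] at h4
      exact (cancel_mono e.hom).1 (h4.trans zero_comp.symm)
    · exact (isZero_stalk_shift_X X i 0 (by lia)).eq_of_tgt _ _

/-- The elementary meaning of `Hom(P_f, P_f[1]) = 0`. -/
theorem exists_eq_add_of_rigid [Module.Projective R P₁] [Module.Projective R P₀]
    (hf : ∀ g : DerivedCategory.Q.obj (twoTerm f) ⟶
      (DerivedCategory.Q.obj (twoTerm f))⟦(1 : ℤ)⟧, g = 0) (h : P₁ →ₗ[R] P₀) :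
    ∃ (s₁ : P₁ →ₗ[R] P₁) (s₀ : P₀ →ₗ[R] P₀), h = f.hom ∘ₗ s₁ + s₀ ∘ₗ f.hom := by
  let e₀ : ((twoTerm f)⟦(1 : ℤ)⟧).X (-1) ≅ P₀ :=
    (twoTerm f).shiftFunctorObjXIso 1 (-1) 0 (by simp) ≪≫ twoTermX₀ f
  let e₁ : ((twoTerm f)⟦(1 : ℤ)⟧).X (-2) ≅ P₁ :=
    (twoTerm f).shiftFunctorObjXIso 1 (-2) (-1) (by simp) ≪≫ twoTermX₁ f
  have hid {A B : ModuleCat.{u} R} (x : A ⟶ B) : -x = -(𝟙 A ≫ x ≫ 𝟙 B) := by simp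
  have hd : ((twoTerm f)⟦(1 : ℤ)⟧).d (-2) (-1) = -(e₁.hom ≫ f ≫ e₀.inv) := by
    have h1 : ((twoTerm f)⟦(1 : ℤ)⟧).d (-2) (-1) =
        -((twoTerm f).shiftFunctorObjXIso 1 (-2) (-1) (by simp)).hom ≫ (twoTerm f).d (-1) 0 ≫
          ((twoTerm f).shiftFunctorObjXIso 1 (-1) 0 (by simp)).inv := by
      rw [shiftFunctor_obj_d']
      simp only [Int.negOnePow_one, Units.neg_smul, one_smul]
      exact hid _
    rw [h1, twoTerm_d]
    simp only [e₀, e₁, Iso.trans_hom, Iso.trans_inv, Category.assoc]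
  have hz : IsZero (((twoTerm f)⟦(1 : ℤ)⟧).X 0) :=
    isZero_twoTerm_X f (0 + 1) (by decide) (by decide)
  obtain ⟨φ, hφ, -⟩ := exists_twoTerm_hom (f := f) (K := (twoTerm f)⟦(1 : ℤ)⟧)
    (ModuleCat.ofHom h ≫ e₀.inv) 0 (hz.eq_of_tgt _ _) zero_comp
  have h0 : DerivedCategory.Q.map φ = 0 := by
    have := hf (DerivedCategory.Q.map φ ≫
      (DerivedCategory.Q.commShiftIso (1 : ℤ)).hom.app (twoTerm f))
    exact (cancel_mono _).1 (this.trans zero_comp.symm)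
  obtain ⟨s₀, s₁, hs, -⟩ := exists_of_Q_map_eq_zero h0
  rw [hφ, Iso.inv_hom_id_assoc, hd, Iso.comp_inv_eq] at hs
  refine ⟨(-(s₁ ≫ e₁.hom)).hom, (s₀ ≫ e₀.hom).hom, ?_⟩
  have h2 : ModuleCat.ofHom h = (-(s₁ ≫ e₁.hom)) ≫ f + f ≫ s₀ ≫ e₀.hom := by
    rw [hs, Preadditive.add_comp, Preadditive.comp_neg, Preadditive.neg_comp, Preadditive.neg_comp,
      add_comm]
    simp only [Category.assoc, Iso.inv_hom_id, Category.comp_id]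
  exact congrArg ModuleCat.Hom.hom h2

/-- The elementary meaning of `Generates`: up to maps that extend along `f`, every map `P₁ → M` is a
sum of composites of endomorphisms of `P_f` with the members of the family. -/
theorem Generates.exists_eq_sum [Module.Projective R P₁] [Module.Projective R P₀]
    {M : ModuleCat.{u} R} {ι : Type u} {a : ι → (twoTerm f ⟶ (stalk M)⟦(1 : ℤ)⟧)}
    (ha : Generates f a) (h : P₁ →ₗ[R] ((stalk M)⟦(1 : ℤ)⟧).X (-1)) :
    ∃ (s : Finset ι) (e₁ : ι → P₁ →ₗ[R] P₁) (e₀ : ι → P₀ →ₗ[R] P₀)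
      (g : P₀ →ₗ[R] ((stalk M)⟦(1 : ℤ)⟧).X (-1)), (∀ i, f.hom ∘ₗ e₁ i = e₀ i ∘ₗ f.hom) ∧
        h = ∑ i ∈ s, ((twoTermX₁ f).inv ≫ (a i).f (-1)).hom ∘ₗ e₁ i + g ∘ₗ f.hom := by
  have := isKProjective_twoTerm f
  obtain ⟨φ, hφ, -⟩ := exists_twoTerm_hom (f := f) (K := (stalk M)⟦(1 : ℤ)⟧)
    (ModuleCat.ofHom h) 0 ((isZero_stalk_shift_X M 1 0 (by decide)).eq_of_tgt _ _) zero_comp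
  obtain ⟨c, hc⟩ := ha (DerivedCategory.Q.map φ)
  choose e he using fun i => Q_map_surjective (P := twoTerm f) (K := twoTerm f) (c i)
  have h0 : DerivedCategory.Q.map (φ - ∑ i ∈ c.support, e i ≫ a i) = 0 := by
    rw [Functor.map_sub, hc, Functor.map_sum, Finsupp.sum, sub_eq_zero]
    simp [he]
  obtain ⟨s₀, s₁, hs, -⟩ := exists_of_Q_map_eq_zero h0
  rw [(isZero_stalk_shift_X M 1 (-2) (by decide)).eq_of_tgt s₁ 0, zero_comp, add_zero] at hs
  refine ⟨c.support, fun i => ((twoTermX₁ f).inv ≫ (e i).f (-1) ≫ (twoTermX₁ f).hom).hom,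
    fun i => ((twoTermX₀ f).inv ≫ (e i).f 0 ≫ (twoTermX₀ f).hom).hom, s₀.hom, fun i => ?_, ?_⟩
  · have h1 := (e i).comm (-1) 0
    simp only [twoTerm_d, ← Category.assoc] at h1
    rw [Iso.comp_inv_eq] at h1
    have h2 : ((twoTermX₁ f).inv ≫ (e i).f (-1) ≫ (twoTermX₁ f).hom) ≫ f =
        f ≫ (twoTermX₀ f).inv ≫ (e i).f 0 ≫ (twoTermX₀ f).hom := by
      simp only [Category.assoc] at h1 ⊢
      rw [h1]
      simp
    exact congrArg ModuleCat.Hom.hom h2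
  · have h1 : ModuleCat.ofHom h = ∑ i ∈ c.support,
        ((twoTermX₁ f).inv ≫ (e i).f (-1) ≫ (twoTermX₁ f).hom) ≫ (twoTermX₁ f).inv ≫ (a i).f (-1) +
          f ≫ s₀ := by
      rw [← hs]
      have h2 : (∑ i ∈ c.support, e i ≫ a i).f (-1) = ∑ i ∈ c.support, (e i ≫ a i).f (-1) :=
        (HomologicalComplex.eval _ _ (-1)).map_sum _ _
      rw [HomologicalComplex.sub_f_apply, Preadditive.comp_sub, h2, Preadditive.comp_sum]
      simp only [hφ, Iso.inv_hom_id_assoc, Category.assoc, Iso.hom_inv_id_assoc,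
        HomologicalComplex.comp_f]
      exact (add_sub_cancel _ _).symm
    have h2 := congrArg ModuleCat.Hom.hom h1
    rw [ModuleCat.hom_add, ModuleCat.hom_sum] at h2
    exact h2

end Derived

/-! ### Top homology as a cokernel -/

section TopHomology

variable {R : Type u} [Ring R]

/-- The projection `K⁰ → H⁰(K)` for a complex `K` with `K¹ = 0`. -/
noncomputable def toHomology (K : CochainComplex (ModuleCat.{u} R) ℤ) (hK : IsZero (K.X 1)) :
    K.X 0 ⟶ K.homology 0 :=
  K.pOpcycles 0 ≫ (K.isoHomologyι 0 1 (by simp) (hK.eq_of_tgt _ _)).inv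

variable (K : CochainComplex (ModuleCat.{u} R) ℤ) (hK : IsZero (K.X 1))

@[simp]
theorem toHomology_homologyι : toHomology K hK ≫ K.homologyι 0 = K.pOpcycles 0 := by
  simp [toHomology]

@[simp]
theorem toHomology_homologyι_comp {A : ModuleCat.{u} R} (k : K.opcycles 0 ⟶ A) :
    toHomology K hK ≫ K.homologyι 0 ≫ k = K.pOpcycles 0 ≫ k := by
  rw [← Category.assoc, toHomology_homologyι]

instance : Epi (toHomology K hK) := by
  unfold toHomology
  infer_instance

theorem d_toHomology : K.d (-1) 0 ≫ toHomology K hK = 0 := by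
  simp [toHomology]

variable {K} in
theorem exists_toHomology_comp_eq {A : ModuleCat.{u} R} (k : K.X 0 ⟶ A) (hk : K.d (-1) 0 ≫ k = 0) :
    ∃ g : K.homology 0 ⟶ A, toHomology K hK ≫ g = k :=
  ⟨K.homologyι 0 ≫ K.descOpcycles k (-1) (by simp) hk, by simp⟩

variable {K} in
theorem toHomology_naturality {L : CochainComplex (ModuleCat.{u} R) ℤ} (hL : IsZero (L.X 1))
    (φ : K ⟶ L) :
    toHomology K hK ≫ HomologicalComplex.homologyMap φ 0 = φ.f 0 ≫ toHomology L hL := by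
  have := L.isIso_homologyι 0 1 (by simp) (hL.eq_of_tgt _ _)
  rw [← cancel_mono (L.homologyι 0)]
  simp

theorem isZero_stalk_X_one (M : ModuleCat.{u} R) : IsZero ((stalk M).X 1) :=
  HomologicalComplex.isZero_single_obj_X (ComplexShape.up ℤ) 0 M 1 (by decide)

theorem singleIso_inv_eq (M : ModuleCat.{u} R) :
    (HomologicalComplex.homologyFunctorSingleIso (ModuleCat.{u} R)
        (ComplexShape.up ℤ) 0).inv.app M =
      (HomologicalComplex.singleObjXSelf (ComplexShape.up ℤ) 0 M).inv ≫
        toHomology (stalk M) (isZero_stalk_X_one M) := by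
  have := (stalk M).isIso_homologyι 0 1 (by simp) ((isZero_stalk_X_one M).eq_of_tgt _ _)
  refine (cancel_mono ((stalk M).homologyι 0)).1 ?_
  rw [Category.assoc, toHomology_homologyι]
  exact HomologicalComplex.singleObjHomologySelfIso_inv_homologyι (ComplexShape.up ℤ) 0 M

variable {P₁ P₀ : ModuleCat.{u} R} (f : P₁ ⟶ P₀)

/-- The projection of `P₀` onto `H⁰(P_f)`, the cokernel of `f`. -/
noncomputable def toCoker : P₀ ⟶ (twoTerm f).homology 0 :=
  (twoTermX₀ f).inv ≫ toHomology (twoTerm f) (isZero_twoTerm_X f 1 (by decide) (by decide))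

instance : Epi (toCoker f) := by
  unfold toCoker
  infer_instance

theorem comp_toCoker : f ≫ toCoker f = 0 := by
  have := d_toHomology (twoTerm f) (isZero_twoTerm_X f 1 (by decide) (by decide))
  rw [twoTerm_d, Category.assoc, Category.assoc] at this
  exact (cancel_epi (twoTermX₁ f).hom).1 (this.trans comp_zero.symm)

theorem exists_toCoker_comp_eq {A : ModuleCat.{u} R} (k : P₀ ⟶ A) (hk : f ≫ k = 0) :
    ∃ g : (twoTerm f).homology 0 ⟶ A, toCoker f ≫ g = k := by
  obtain ⟨g, hg⟩ := exists_toHomology_comp_eq (isZero_twoTerm_X f 1 (by decide) (by decide))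
    ((twoTermX₀ f).hom ≫ k) (by simp [twoTerm_d, hk])
  exact ⟨g, by simp [toCoker, hg]⟩

end TopHomology

/-! ### Terms of a coproduct of complexes -/

section Coproduct

variable {R : Type u} [Ring R] {ι : Type u} (K : ι → CochainComplex (ModuleCat.{u} R) ℤ) (n : ℤ)
  {A : ModuleCat.{u} R}

/-- The terms of degree `n` of the coproduct form a coproduct of the terms of degree `n`. -/
noncomputable def isColimitCoproductX :
    IsColimit ((HomologicalComplex.eval _ _ n).mapCocone (colimit.cocone (Discrete.functor K))) :=
  isColimitOfPreserves _ (colimit.isColimit _)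

variable {K n}

theorem coproductX_hom_ext {g g' : (∐ K).X n ⟶ A}
    (h : ∀ i, (Sigma.ι K i).f n ≫ g = (Sigma.ι K i).f n ≫ g') : g = g' :=
  (isColimitCoproductX K n).hom_ext fun ⟨i⟩ => h i

theorem exists_coproductX_desc (k : ∀ i, (K i).X n ⟶ A) :
    ∃ g : (∐ K).X n ⟶ A, ∀ i, (Sigma.ι K i).f n ≫ g = k i :=
  ⟨(isColimitCoproductX K n).desc ⟨A, Discrete.natTrans fun ⟨i⟩ => k i⟩,
    fun i => (isColimitCoproductX K n).fac _ ⟨i⟩⟩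

theorem isZero_coproduct_X (h : ∀ i, IsZero ((K i).X n)) : IsZero ((∐ K).X n) := by
  rw [IsZero.iff_id_eq_zero]
  exact coproductX_hom_ext fun i => (h i).eq_of_src _ _

end Coproduct

/-! ### A presentation of `H⁰(cone(ω)[-1])`

The complex `G` stands for `M[1]`: only its vanishing in the degrees `0` and `-2` matters. -/

section Bar

open CochainComplex

variable {R : Type u} [Ring R] {P₁ P₀ : ModuleCat.{u} R} {f : P₁ ⟶ P₀}
  {G : CochainComplex (ModuleCat.{u} R) ℤ} {ι : Type u} (a : ι → (twoTerm f ⟶ G))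

/-- The cone of the map from a coproduct of copies of `P_f` with the given components. -/
noncomputable abbrev coneDesc : CochainComplex (ModuleCat.{u} R) ℤ :=
  mappingCone (Sigma.desc a)

theorem isZero_coneDesc_X (hG : IsZero (G.X 0)) :
    IsZero (((coneDesc a)⟦(-1 : ℤ)⟧).X 1) := by
  have h : IsZero ((coneDesc a).X 0) := (mappingCone.isZero_X_iff _ _).2
    ⟨isZero_coproduct_X fun _ => isZero_twoTerm_X f 1 (by decide) (by decide), hG⟩
  exact h

theorem shift_neg_one_d (K : CochainComplex (ModuleCat.{u} R) ℤ) :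
    (K⟦(-1 : ℤ)⟧).d (-1) 0 = -K.d (-2) (-1) := by
  rw [shiftFunctor_obj_d', Int.negOnePow_neg, Int.negOnePow_one, Units.neg_smul, one_smul]
  rfl

variable (hG : IsZero (G.X 0))

/-- The projection of the term of degree `-1` of `cone(ω)` onto `H⁰(cone(ω)[-1])`. -/
noncomputable def coneProj : (coneDesc a).X (-1) ⟶ ((coneDesc a)⟦(-1 : ℤ)⟧).homology 0 :=
  toHomology ((coneDesc a)⟦(-1 : ℤ)⟧) (isZero_coneDesc_X a hG)

instance : Epi (coneProj a hG) :=
  inferInstanceAs (Epi (toHomology ((coneDesc a)⟦(-1 : ℤ)⟧) (isZero_coneDesc_X a hG)))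

theorem d_coneProj : (coneDesc a).d (-2) (-1) ≫ coneProj a hG = 0 := by
  have := d_toHomology ((coneDesc a)⟦(-1 : ℤ)⟧) (isZero_coneDesc_X a hG)
  rw [shift_neg_one_d] at this
  exact neg_eq_zero.1 ((Preadditive.neg_comp _ _).symm.trans this)

theorem exists_coneProj_comp_eq {A : ModuleCat.{u} R} (k : (coneDesc a).X (-1) ⟶ A)
    (hk : (coneDesc a).d (-2) (-1) ≫ k = 0) : ∃ g, coneProj a hG ≫ g = k :=
  exists_toHomology_comp_eq (isZero_coneDesc_X a hG) (K := (coneDesc a)⟦(-1 : ℤ)⟧) k (by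
    rw [shift_neg_one_d]
    exact (Preadditive.neg_comp _ _).trans (neg_eq_zero.2 hk))

/-- The map from the bottom term of `G` to `H⁰(cone(ω)[-1])`. -/
noncomputable def glueBase : G.X (-1) ⟶ ((coneDesc a)⟦(-1 : ℤ)⟧).homology 0 :=
  (mappingCone.inr (Sigma.desc a)).f (-1) ≫ coneProj a hG

/-- The map `P₀ → H⁰(cone(ω)[-1])` that comes from the `i`-th copy of `P_f`. -/
noncomputable def glueCell (i : ι) : P₀ ⟶ ((coneDesc a)⟦(-1 : ℤ)⟧).homology 0 :=
  (twoTermX₀ f).inv ≫ (Sigma.ι (fun _ : ι => twoTerm f) i).f 0 ≫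
    (mappingCone.inl (Sigma.desc a)).v 0 (-1) (by simp) ≫ coneProj a hG

/-- The bottom component of the `i`-th member of the family. -/
noncomputable def attach (i : ι) : P₁ ⟶ G.X (-1) :=
  (twoTermX₁ f).inv ≫ (a i).f (-1)

theorem ι_desc_f_comp (i : ι) (n : ℤ) {A : ModuleCat.{u} R} (k : G.X n ⟶ A) :
    (Sigma.ι (fun _ : ι => twoTerm f) i).f n ≫ (Sigma.desc a).f n ≫ k = (a i).f n ≫ k := by
  rw [← Category.assoc, ← HomologicalComplex.comp_f, Sigma.ι_desc]

theorem comp_glueCell (i : ι) : f ≫ glueCell a hG i = attach a i ≫ glueBase a hG := by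
  have h := congrArg (· ≫ coneProj a hG)
    (mappingCone.inl_v_d (Sigma.desc a) (-1) (-2) 0 (by simp) (by simp))
  simp only [Category.assoc, d_coneProj, comp_zero, Preadditive.sub_comp] at h
  rw [attach, glueBase, Category.assoc, ← ι_desc_f_comp, sub_eq_zero.1 h.symm,
    HomologicalComplex.Hom.comm_assoc, twoTerm_d, glueCell]
  simp

/-- The module `H⁰(cone(ω)[-1])` is generated by the bottom term of `G` and the copies of `P₀`. -/
theorem glue_hom_ext {A : ModuleCat.{u} R} {g g' : ((coneDesc a)⟦(-1 : ℤ)⟧).homology 0 ⟶ A}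
    (h : glueBase a hG ≫ g = glueBase a hG ≫ g')
    (h' : ∀ i, glueCell a hG i ≫ g = glueCell a hG i ≫ g') : g = g' := by
  rw [← cancel_epi (coneProj a hG)]
  refine mappingCone.ext_from _ 0 (-1) (by simp) (coproductX_hom_ext fun i => ?_)
    (by simpa [glueBase] using h)
  rw [← cancel_epi (twoTermX₀ f).inv]
  simpa [glueCell] using h' i

/-- The pushout property of `H⁰(cone(ω)[-1])`. -/
theorem exists_glue_desc (hG' : IsZero (G.X (-2))) {A : ModuleCat.{u} R} (x : G.X (-1) ⟶ A)
    (y : ι → (P₀ ⟶ A)) (h : ∀ i, f ≫ y i = attach a i ≫ x) :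
    ∃ g : ((coneDesc a)⟦(-1 : ℤ)⟧).homology 0 ⟶ A,
      glueBase a hG ≫ g = x ∧ ∀ i, glueCell a hG i ≫ g = y i := by
  obtain ⟨Y, hY⟩ := exists_coproductX_desc (K := fun _ : ι => twoTerm f) (n := 0)
    fun i => (twoTermX₀ f).hom ≫ y i
  obtain ⟨k, hk⟩ : ∃ k, k = (mappingCone.fst (Sigma.desc a)).1.v (-1) 0 (by simp) ≫ Y +
      (mappingCone.snd (Sigma.desc a)).v (-1) (-1) (by simp) ≫ x := ⟨_, rfl⟩
  have hk₁ : (mappingCone.inl (Sigma.desc a)).v 0 (-1) (by simp) ≫ k = Y := by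
    simp [hk]
  have hk₂ : (mappingCone.inr (Sigma.desc a)).f (-1) ≫ k = x := by
    simp [hk]
  obtain ⟨g, hg⟩ := exists_coneProj_comp_eq a hG k (by
    refine mappingCone.ext_from _ (-1) (-2) (by simp) (coproductX_hom_ext fun i => ?_)
      (hG'.eq_of_src _ _)
    have h1 := congrArg (· ≫ k)
      (mappingCone.inl_v_d (Sigma.desc a) (-1) (-2) 0 (by simp) (by simp))
    simp only [Category.assoc, Preadditive.sub_comp, hk₁, hk₂] at h1
    rw [h1, Preadditive.comp_sub, ι_desc_f_comp, HomologicalComplex.Hom.comm_assoc, hY, twoTerm_d]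
    have h2 := h i
    rw [attach, Category.assoc, Iso.eq_inv_comp] at h2
    simp [← h2])
  refine ⟨g, ?_, fun i => ?_⟩
  · rw [glueBase, Category.assoc, hg, hk₂]
  · simp only [glueCell, Category.assoc]
    rw [hg, hk₁, hY, Iso.inv_hom_id_assoc]

theorem range_glueBase_sup :
    LinearMap.range (glueBase a hG).hom ⊔ ⨆ i, LinearMap.range (glueCell a hG i).hom = ⊤ := by
  set T := LinearMap.range (glueBase a hG).hom ⊔ ⨆ i, LinearMap.range (glueCell a hG i).hom
  have h : ModuleCat.ofHom T.mkQ = 0 := by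
    refine glue_hom_ext a hG ?_ fun i => ?_
    · ext x
      exact (Submodule.Quotient.mk_eq_zero T).2 (Submodule.mem_sup_left ⟨x, rfl⟩)
    · ext x
      exact (Submodule.Quotient.mk_eq_zero T).2
        (Submodule.mem_sup_right (Submodule.mem_iSup_of_mem i ⟨x, rfl⟩))
  rw [← T.ker_mkQ]
  exact LinearMap.ker_eq_top.2 (congrArg ModuleCat.Hom.hom h)

/-- The isomorphism from `M` to the term of degree `-1` of `M[1]` that underlies `toBar`. -/
noncomputable def toShift (M : ModuleCat.{u} R) : M ≅ ((stalk M)⟦(1 : ℤ)⟧).X (-1) :=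
  (HomologicalComplex.singleObjXSelf (ComplexShape.up ℤ) 0 M).symm ≪≫
    HomologicalComplex.Hom.isoApp
      ((shiftFunctorCompIsoId (CochainComplex (ModuleCat.{u} R) ℤ) (1 : ℤ) (-1)
        (by norm_num)).symm.app (stalk M)) 0 ≪≫
    ((stalk M)⟦(1 : ℤ)⟧).shiftFunctorObjXIso (-1) 0 (-1) (by simp)

/-- The projection of `H⁰(cone(ω)[-1])` onto its quotient by the trace of `H⁰(P_f)`. -/
noncomputable def reflProj {M : ModuleCat.{u} R} (a : ι → (twoTerm f ⟶ (stalk M)⟦(1 : ℤ)⟧)) :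
    ((coneDesc a)⟦(-1 : ℤ)⟧).homology 0 ⟶ refl a :=
  ModuleCat.ofHom (Submodule.mkQ (trace ((twoTerm f).homology 0) ((bar a).homology 0)))

theorem unitMap_eq {M : ModuleCat.{u} R} (a : ι → (twoTerm f ⟶ (stalk M)⟦(1 : ℤ)⟧)) :
    unitMap a = (toShift M).hom ≫ glueBase a (isZero_stalk_shift_X M 1 0 (by decide)) ≫
      reflProj a := by
  have hz : IsZero ((bar a).X 1) := isZero_coneDesc_X a (isZero_stalk_shift_X M 1 0 (by decide))
  have h₁ : (HomologicalComplex.homologyFunctorSingleIso (ModuleCat.{u} R)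
        (ComplexShape.up ℤ) 0).inv.app M ≫ HomologicalComplex.homologyMap (toBar a) 0 =
      (HomologicalComplex.singleObjXSelf (ComplexShape.up ℤ) 0 M).inv ≫
        (toBar a).f 0 ≫ toHomology (bar a) hz := by
    rw [← toHomology_naturality (isZero_stalk_X_one M) hz, ← Category.assoc, ← singleIso_inv_eq]
    rfl
  have h₂ : (toBar a).f 0 ≫ toHomology (bar a) hz =
      ((shiftFunctorCompIsoId (CochainComplex (ModuleCat.{u} R) ℤ) (1 : ℤ) (-1)
        (by norm_num)).inv.app (stalk M)).f 0 ≫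
      (((stalk M)⟦(1 : ℤ)⟧).shiftFunctorObjXIso (-1) 0 (-1) (by simp)).hom ≫
        glueBase a (isZero_stalk_shift_X M 1 0 (by decide)) := rfl
  have h₃ : (HomologicalComplex.homologyFunctorSingleIso (ModuleCat.{u} R)
        (ComplexShape.up ℤ) 0).inv.app M ≫ HomologicalComplex.homologyMap (toBar a) 0 =
      (toShift M).hom ≫ glueBase a (isZero_stalk_shift_X M 1 0 (by decide)) := by
    rw [h₁, h₂]
    simp only [toShift, Iso.trans_hom, Category.assoc]
    rfl
  exact (Category.assoc _ _ _).symm.trans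
    ((congrArg (· ≫ reflProj a) h₃).trans (Category.assoc _ _ _))

end Bar

/-! ### The reflection -/

section Universal

variable {R : Type u} [Ring R] {P₁ P₀ : ModuleCat.{u} R} {f : P₁ ⟶ P₀} {M : ModuleCat.{u} R}
  {ι : Type u}

/-- Every map from `M` to a local module factors uniquely through `unitMap a`; this needs neither
rigidity nor generation. -/
theorem existsUnique_unitMap_comp_eq (a : ι → (twoTerm f ⟶ (stalk M)⟦(1 : ℤ)⟧))
    {X : ModuleCat.{u} R} (hX : IsLocalAt (RingHom.id R) f.hom X) (x : M ⟶ X) :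
    ∃! t : refl a ⟶ X, unitMap a ≫ t = x := by
  have hG : IsZero (((stalk M)⟦(1 : ℤ)⟧).X 0) := isZero_stalk_shift_X M 1 0 (by decide)
  have : Epi (reflProj a) := (ModuleCat.epi_iff_surjective _).2 (Submodule.mkQ_surjective _)
  have hom_ext {y z : P₀ ⟶ X} (h : f ≫ y = f ≫ z) : y = z :=
    ModuleCat.hom_ext (hX.1 (congrArg ModuleCat.Hom.hom h))
  have exists_ext (y : P₁ ⟶ X) : ∃ z : P₀ ⟶ X, f ≫ z = y := by
    obtain ⟨z, hz⟩ := hX.2 y.hom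
    exact ⟨ModuleCat.ofHom z, ModuleCat.hom_ext hz⟩
  refine existsUnique_of_exists_of_unique ?_ fun t t' ht ht' => ?_
  · choose y hy using fun i => exists_ext (attach a i ≫ (toShift M).inv ≫ x)
    obtain ⟨g, hg, -⟩ := exists_glue_desc a hG (isZero_stalk_shift_X M 1 (-2) (by decide))
      ((toShift M).inv ≫ x) y hy
    have hle : trace ((twoTerm f).homology 0) ((bar a).homology 0) ≤ LinearMap.ker g.hom := by
      refine iSup_le fun k => ?_
      have h1 : toCoker f ≫ k ≫ g = 0 := hom_ext (by
        rw [← Category.assoc, comp_toCoker, zero_comp, comp_zero])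
      have h2 : k ≫ g = 0 := (cancel_epi (toCoker f)).1 (h1.trans comp_zero.symm)
      rintro _ ⟨c, rfl⟩
      exact LinearMap.congr_fun (congrArg ModuleCat.Hom.hom h2) c
    obtain ⟨t, ht⟩ : ∃ t : refl a ⟶ X, reflProj a ≫ t = g :=
      ⟨ModuleCat.ofHom (Submodule.liftQ _ g.hom hle),
        ModuleCat.hom_ext (Submodule.liftQ_mkQ _ _ hle)⟩
    refine ⟨t, ?_⟩
    rw [unitMap_eq, Category.assoc, Category.assoc, ht, hg, Iso.hom_inv_id_assoc]
  · refine (cancel_epi (reflProj a)).1 ?_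
    have h1 : glueBase a hG ≫ reflProj a ≫ t = glueBase a hG ≫ reflProj a ≫ t' := by
      refine (cancel_epi (toShift M).hom).1 ?_
      have := ht.trans ht'.symm
      rw [unitMap_eq] at this
      simpa only [Category.assoc] using this
    refine glue_hom_ext a hG h1 fun i => hom_ext ?_
    rw [← Category.assoc, comp_glueCell, Category.assoc, ← Category.assoc f, comp_glueCell,
      Category.assoc]
    exact congrArg (attach a i ≫ ·) h1

/-- Reflections of all modules assemble to a left adjoint of the inclusion. -/
theorem exists_adjunction (P : ObjectProperty (ModuleCat.{u} R))
    (L : ModuleCat.{u} R → ModuleCat.{u} R)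
    (hL : ∀ M, P (L M)) (η : ∀ M, M ⟶ L M)
    (h : ∀ M X, P X → ∀ x : M ⟶ X, ∃! t : L M ⟶ X, η M ≫ t = x) :
    ∃ (l : ModuleCat.{u} R ⥤ P.FullSubcategory) (adj : l ⊣ P.ι)
      (e : ∀ M : ModuleCat.{u} R, (l.obj M).obj ≅ L M), ∀ M, adj.unit.app M ≫ (e M).hom = η M := by
  let e (M : ModuleCat.{u} R) (X : P.FullSubcategory) :
      ((⟨L M, hL M⟩ : P.FullSubcategory) ⟶ X) ≃ (M ⟶ P.ι.obj X) :=
    Equiv.ofBijective (fun t => η M ≫ P.ι.map t) (by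
      refine ⟨fun t t' ht => ?_, fun x => ?_⟩
      · exact P.ι.map_injective ((h M X.obj X.property _).unique ht rfl)
      · obtain ⟨t, ht, -⟩ := h M X.obj X.property x
        exact ⟨P.fullyFaithfulι.preimage t, ht⟩)
  have he (M : ModuleCat.{u} R) (X Y : P.FullSubcategory) (g : X ⟶ Y)
      (t : (⟨L M, hL M⟩ : P.FullSubcategory) ⟶ X) : e M Y (t ≫ g) = e M X t ≫ P.ι.map g := by
    change η M ≫ P.ι.map (t ≫ g) = (η M ≫ P.ι.map t) ≫ P.ι.map g
    rw [Functor.map_comp, Category.assoc]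
  refine ⟨_, Adjunction.adjunctionOfEquivLeft e he, fun M => Iso.refl _, fun M => ?_⟩
  rw [Iso.refl_hom]
  refine (Category.comp_id _).trans ?_
  rw [Adjunction.adjunctionOfEquivLeft, Adjunction.mkOfHomEquiv_unit_app]
  exact Category.comp_id (η M)

end Universal

section Reflection

variable {R : Type u} [Ring R] [HasDerivedCategory.{w} (ModuleCat.{u} R)]
  {P₁ P₀ : ModuleCat.{u} R} [Module.Projective R P₁] [Module.Projective R P₀] {f : P₁ ⟶ P₀}

/-- If `Hom(P_f, P_f[1]) = 0`, the cokernel of `f` has the extension property. -/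
theorem extendsAlong_homology (hf : ∀ g : DerivedCategory.Q.obj (twoTerm f) ⟶
      (DerivedCategory.Q.obj (twoTerm f))⟦(1 : ℤ)⟧, g = 0) :
    ExtendsAlong f.hom ((twoTerm f).homology 0) := by
  intro h
  obtain ⟨h', rfl⟩ := Module.projective_lifting_property (toCoker f).hom h
    ((ModuleCat.epi_iff_surjective _).1 inferInstance)
  obtain ⟨s₁, s₀, rfl⟩ := exists_eq_add_of_rigid hf h'
  refine ⟨(toCoker f).hom ∘ₗ s₀, ?_⟩
  have h0 : (toCoker f).hom ∘ₗ f.hom = 0 := congrArg ModuleCat.Hom.hom (comp_toCoker f)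
  change ((toCoker f).hom ∘ₗ s₀) ∘ₗ f.hom = _
  rw [LinearMap.comp_add, ← LinearMap.comp_assoc s₁, h0, LinearMap.zero_comp, zero_add,
    LinearMap.comp_assoc]

variable {M : ModuleCat.{u} R} {ι : Type u} {a : ι → (twoTerm f ⟶ (stalk M)⟦(1 : ℤ)⟧)}

/-- The explicit module is in the perpendicular category. -/
theorem isLocalAt_refl [Module.Finite R P₁]
    (hf : ∀ g : DerivedCategory.Q.obj (twoTerm f) ⟶
      (DerivedCategory.Q.obj (twoTerm f))⟦(1 : ℤ)⟧, g = 0) (ha : Generates f a) :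
    IsLocalAt (RingHom.id R) f.hom (refl a) := by
  have hG : IsZero (((stalk M)⟦(1 : ℤ)⟧).X 0) := isZero_stalk_shift_X M 1 0 (by decide)
  have hN : ExtendsAlong f.hom ((bar a).homology 0) :=
    ExtendsAlong.of_glueing (α := fun i => (attach a i).hom) (ν := (glueBase a hG).hom)
      (ρ := fun i => (glueCell a hG i).hom)
      (fun i => congrArg ModuleCat.Hom.hom (comp_glueCell a hG i)) (range_glueBase_sup a hG)
      (exists_eq_add_of_rigid hf) ha.exists_eq_sum
  refine hN.isLocalAt_quotient _ ((extendsAlong_homology hf).of_iSup_range _) fun g hg => ?_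
  obtain ⟨k, hk⟩ := exists_toCoker_comp_eq f (ModuleCat.ofHom g) (ModuleCat.hom_ext hg)
  have hk' : g = k.hom ∘ₗ (toCoker f).hom := (congrArg ModuleCat.Hom.hom hk).symm
  rw [hk']
  exact (LinearMap.range_comp_le_range _ _).trans
    (le_iSup (fun k : (twoTerm f).homology 0 ⟶ (bar a).homology 0 => LinearMap.range k.hom) k)

/-- All chain maps together form a generating family. -/
theorem generates_all (f : P₁ ⟶ P₀) (M : ModuleCat.{u} R) :
    Generates f (M := M) (ι := twoTerm f ⟶ (stalk M)⟦(1 : ℤ)⟧) id := by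
  intro g
  have := isKProjective_twoTerm f
  obtain ⟨φ, rfl⟩ := Q_map_surjective g
  exact ⟨Finsupp.single φ (𝟙 _), by simp⟩

/-- The unit at `R` of a left adjoint of the inclusion, evaluated at `1`. -/
theorem isReflectionOfRing_unit {l : ModuleCat.{u} R ⥤ (perp f).FullSubcategory}
    (adj : l ⊣ (perp f).ι) :
    IsReflectionOfRing f.hom (L := (l.obj (ModuleCat.of R R)).obj)
      ((adj.unit.app (ModuleCat.of R R)).hom (1 : R)) where
  isLocalAt := (perp_iff_isLocalAt _).1 (l.obj (ModuleCat.of R R)).property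
  existsUnique X _ _ hX x := by
    let X' : (perp f).FullSubcategory := ⟨ModuleCat.of R X, (perp_iff_isLocalAt _).2 hX⟩
    refine existsUnique_of_exists_of_unique ?_ fun t t' ht ht' => ?_
    · obtain ⟨t, ht⟩ := (adj.homEquiv (ModuleCat.of R R) X').surjective
        (ModuleCat.ofHom (LinearMap.toSpanSingleton R X x))
      refine ⟨((perp f).ι.map t).hom, ?_⟩
      rw [Adjunction.homEquiv_unit] at ht
      have := LinearMap.congr_fun (congrArg ModuleCat.Hom.hom ht) (1 : R)
      exact this.trans (LinearMap.toSpanSingleton_apply_one R X x)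
    · let T (s : (l.obj (ModuleCat.of R R)).obj →ₗ[R] X) : l.obj (ModuleCat.of R R) ⟶ X' :=
        (perp f).fullyFaithfulι.preimage (ModuleCat.ofHom s)
      have h : T t = T t' := (adj.homEquiv _ _).injective (by
        rw [Adjunction.homEquiv_unit, Adjunction.homEquiv_unit]
        refine ModuleCat.hom_ext (LinearMap.ext_ring ?_)
        exact ht.trans ht'.symm)
      have h' := congrArg (perp f).ι.map h
      exact congrArg ModuleCat.Hom.hom h'

end Reflection

end PerpLoc

open PerpLoc in
theorem corollary3p10 {R : Type u} [Ring R] [HasDerivedCategory.{w} (ModuleCat.{u} R)]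
    {P₁ P₀ : ModuleCat.{u} R} [Module.Finite R P₁] [Module.Projective R P₁]
    [Module.Finite R P₀] [Module.Projective R P₀] (f : P₁ ⟶ P₀)
    (hf : ∀ g : DerivedCategory.Q.obj (twoTerm f) ⟶
      (DerivedCategory.Q.obj (twoTerm f))⟦(1 : ℤ)⟧, g = 0) :
    -- the inclusion of the perpendicular category has a left adjoint
    (perp f).ι.IsRightAdjoint ∧
    -- which is given by the explicit construction, for every choice of generating families
    (∀ (ι : ModuleCat.{u} R → Type u)
        (a : ∀ M : ModuleCat.{u} R, ι M → (twoTerm f ⟶ (stalk M)⟦(1 : ℤ)⟧)),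
        (∀ M, Generates f (a M)) →
        ∃ (l : ModuleCat.{u} R ⥤ (perp f).FullSubcategory) (adj : l ⊣ (perp f).ι)
          (e : ∀ M : ModuleCat.{u} R, (l.obj M).obj ≅ refl (a M)),
          ∀ M : ModuleCat.{u} R, adj.unit.app M ≫ (e M).hom = unitMap (a M)) ∧
    -- the universal localization exists and, for every left adjoint `l` of the inclusion, it is
    -- isomorphic to the endomorphism ring of `l(R)` (endomorphisms of left modules are written on
    -- the right, so that the product `s t` is `s` followed by `t`)
    (∃ (S : Type u) (_ : Ring S) (lam : R →+* S), IsUniversalLocalization lam f.hom) ∧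
    ∀ (l : ModuleCat.{u} R ⥤ (perp f).FullSubcategory), (l ⊣ (perp f).ι) →
      ∀ (S : Type u) [Ring S] (lam : R →+* S), IsUniversalLocalization lam f.hom →
        Nonempty (S ≃+* (Module.End R (l.obj (ModuleCat.of R R)).obj)ᵐᵒᵖ) := by
  have main (ι : ModuleCat.{u} R → Type u)
      (a : ∀ M : ModuleCat.{u} R, ι M → (twoTerm f ⟶ (stalk M)⟦(1 : ℤ)⟧))
      (ha : ∀ M, Generates f (a M)) :=
    exists_adjunction (perp f) (fun M => refl (a M))
      (fun M => (perp_iff_isLocalAt _).2 (isLocalAt_refl hf (ha M))) (fun M => unitMap (a M))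
      fun M X hX => existsUnique_unitMap_comp_eq (a M) ((perp_iff_isLocalAt X).1 hX)
  obtain ⟨l₀, adj₀, -⟩ := main _ _ (generates_all f)
  exact ⟨adj₀.isRightAdjoint, main,
    ⟨_, _, _, (isReflectionOfRing_unit adj₀).isUniversalLocalization⟩,
    fun l adj S _ lam hlam =>
      hlam.nonempty_ringEquiv (isReflectionOfRing_unit adj).isUniversalLocalization⟩
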